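/- Let $\mathcal{A}$ be a unital $C^*$-algebra and let $M$ be a Hilbert $\mathcal{A}$-module. Denote by $B^a(M)$ the algebra of all bounded, $\mathcal{A}$-linear, adjointable operators on $M$, and let $\tilde{\mathcal{M}\Phi}_0^{gc}(M)$ be the class of all $F \in B^a(M)$ with closed range for which there exist finitely generated Hilbert $\mathcal{A}$-modules $N$ and $\tilde N$ such that $$N \oplus \ker F \;\cong\; \tilde N \oplus (\operatorname{Im} F)^{\perp},$$ where $\oplus$ is the direct sum of Hilbert $\mathcal{A}$-modules, $(\operatorname{Im} F)^{\perp}$ is the orthogonal complement of the range with respect to the $\mathcal{A}$-valued inner product, and $\cong$ means that there is a bounded $\mathcal{A}$-linear bijection with bounded inverse. If $F, D \in \tilde{\mathcal{M}\Phi}_0^{gc}(M)$ and $\operatorname{Im}(DF)$ is closed, then $DF \in \tilde{\mathcal{M}\Phi}_0^{gc}(M)$. -/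

import Mathlib

/-- A finitely generated Hilbert module over the unital C⋆-algebra `A`: a complete `CStarModule`
over `A` that is generated, as an `A`-module, by finitely many elements. -/
structure FGHilbertModule.{u} (A : Type u) [CStarAlgebra A] [PartialOrder A] where
  carrier : Type u
  [normedAddCommGroup : NormedAddCommGroup carrier]
  [normedSpace : NormedSpace ℂ carrier]
  [module : Module A carrier]
  [cstarModule : CStarModule A carrier]
  [completeSpace : CompleteSpace carrier]
  [finite : Module.Finite A carrier]

namespace FGHilbertModule

attribute [instance] normedAddCommGroup normedSpace module cstarModule completeSpace finite

end FGHilbertModule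

namespace HilbertModule

variable {A M M' : Type*} [CStarAlgebra A] [PartialOrder A]
  [NormedAddCommGroup M] [NormedSpace ℂ M] [Module A M] [CStarModule A M]
  [NormedAddCommGroup M'] [NormedSpace ℂ M'] [Module A M'] [CStarModule A M']

/-- The orthogonal complement of a submodule with respect to the `A`-valued inner product. -/
def orthogonal (S : Submodule A M) : Submodule A M where
  carrier := {y | ∀ x ∈ S, inner A x y = 0}
  add_mem' hy hz x hx := by
    rw [CStarModule.inner_add_right, hy x hx, hz x hx, add_zero]
  zero_mem' _ _ := CStarModule.inner_zero_right
  smul_mem' a y hy x hx := by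
    rw [CStarModule.inner_op_smul_right, hy x hx, mul_zero]

/-- A bounded `A`-linear operator `F : M → M'` is adjointable if there is a bounded `A`-linear
operator `G : M' → M` with `⟨F x, y⟩ = ⟨x, G y⟩` for all `x` and `y`. -/
def IsAdjointable (F : M →L[A] M') : Prop :=
  ∃ G : M' →L[A] M, ∀ x y, inner A (F x) y = inner A x (G y)

end HilbertModule

open HilbertModule in
/-- The class `M̃Φ₀^{gc}(M, M')`: adjointable operators `F` with closed range for which there are
finitely generated Hilbert modules `N`, `N'` with `N ⊕ ker F ≅ N' ⊕ (Im F)^⊥`. Here `≅` is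
isomorphism through a bounded `A`-linear bijection with bounded inverse; the norm of the
Hilbert-module direct sum `N ⊕ ker F` induces the product topology on `N × ker F`. -/
def IsStablyGeneralizedWeyl.{u, v, w} {A : Type u} {M : Type v} {M' : Type w}
    [CStarAlgebra A] [PartialOrder A]
    [NormedAddCommGroup M] [NormedSpace ℂ M] [Module A M] [CStarModule A M]
    [NormedAddCommGroup M'] [NormedSpace ℂ M'] [Module A M'] [CStarModule A M']
    (F : M →L[A] M') : Prop :=
  IsAdjointable F ∧ IsClosed (Set.range F) ∧
    ∃ N N' : FGHilbertModule A,
      Nonempty ((N.carrier × LinearMap.ker (F : M →ₗ[A] M')) ≃L[A]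
        (N'.carrier × orthogonal (LinearMap.range (F : M →ₗ[A] M'))))

/-! Closed range makes F, D and DF split: each has a generalized inverse
(`exists_generalized_inverse`), because FF* is invertible on Im F. Put I = Im F ∩ ker D, let K be a
complement of I in ker D, and let T be a complement of Im F + ker D. Then ker DF ≅ ker F ⊕ I, ker D
≅ I ⊕ K, (Im F)^⊥ ≅ K ⊕ T, (Im DF)^⊥ ≅ (Im D)^⊥ ⊕ T. Adding the relations for F and D, (Im F)^⊥
contributes the K that completes I to ker D, and its leftover T completes (Im D)^⊥ to (Im DF)^⊥.
Nothing is cancelled, and the finitely generated summands simply add up. -/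

/-- If `P + s` is bounded below by the same positive constant for all `s ≥ 0`, then `P` is
invertible. -/
theorem ContinuousLinearMap.isUnit_of_forall_le_norm_add_smul {E : Type*} [NormedAddCommGroup E]
    [NormedSpace ℝ E] [CompleteSpace E] (P : E →L[ℝ] E) {c : ℝ} (hc : 0 < c)
    (h : ∀ s : ℝ, 0 ≤ s → ∀ y, c * ‖y‖ ≤ ‖P y + s • y‖) : IsUnit P := by
  nontriviality (E →L[ℝ] E)
  -- The inverse at `s` has norm at most `c⁻¹`, so invertibility persists within distance `c`,
  -- uniformly in `s`.
  have step : ∀ s s' : ℝ, 0 ≤ s → |s' - s| < c → IsUnit (P + s • (1 : E →L[ℝ] E)) →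
      IsUnit (P + s' • (1 : E →L[ℝ] E)) := by
    rintro s s' hs hss ⟨u, hu⟩
    have hinv : ‖(↑u⁻¹ : E →L[ℝ] E)‖ ≤ c⁻¹ := by
      refine ContinuousLinearMap.opNorm_le_bound _ (by positivity) fun y => ?_
      have h1 : (u : E →L[ℝ] E) ((↑u⁻¹ : E →L[ℝ] E) y) = y := by
        rw [← mul_apply_eq_comp, Units.mul_inv, one_apply_eq_self]
      have h2 := h s hs ((↑u⁻¹ : E →L[ℝ] E) y)
      rw [hu] at h1
      simp only [add_apply, smul_apply,
        one_apply_eq_self] at h1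
      rw [h1] at h2
      rw [inv_mul_eq_div, le_div_iff₀ hc]
      linarith
    have hpos : 0 < ‖(↑u⁻¹ : E →L[ℝ] E)‖ := Units.norm_pos u⁻¹
    refine (u.ofNearby (P + s' • (1 : E →L[ℝ] E)) ?_).isUnit
    have h3 : c ≤ ‖(↑u⁻¹ : E →L[ℝ] E)‖⁻¹ := (le_inv_comm₀ hpos hc).1 hinv
    refine lt_of_le_of_lt ?_ (hss.trans_le h3)
    rw [hu, add_sub_add_left_eq_sub, ← sub_smul]
    refine (norm_smul_le _ _).trans ?_
    exact mul_le_of_le_one_right (norm_nonneg _) ContinuousLinearMap.norm_id_le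
  obtain ⟨s₀, hs₀, hu₀⟩ : ∃ s₀ : ℝ, 0 ≤ s₀ ∧ IsUnit (P + s₀ • (1 : E →L[ℝ] E)) := by
    refine ⟨‖P‖ * ‖(1 : E →L[ℝ] E)‖ + 1, by positivity, ?_⟩
    have := spectrum.mem_resolventSet_of_norm_lt_mul (𝕜 := ℝ) (a := -P)
      (k := ‖P‖ * ‖(1 : E →L[ℝ] E)‖ + 1)
      (by rw [norm_neg, Real.norm_of_nonneg (by positivity)]; linarith)
    rw [spectrum.mem_resolventSet_iff, sub_neg_eq_add, Algebra.algebraMap_eq_smul_one,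
      add_comm] at this
    exact this
  -- Walk from a large `s₀` down to 0 in steps of `c / 2`; the `max` stops the walk at 0.
  have descend : ∀ n : ℕ, IsUnit (P + max (s₀ - n * (c / 2)) 0 • (1 : E →L[ℝ] E)) := by
    intro n
    induction n with
    | zero => simpa [max_eq_left hs₀] using hu₀
    | succ n ih =>
      refine step _ _ (le_max_right _ _) ?_ ih
      refine (abs_max_sub_max_le_abs _ _ _).trans_lt ?_
      push_cast
      rw [abs_lt]
      constructor <;> linarith
  obtain ⟨n, hn⟩ := exists_nat_gt (s₀ / (c / 2))
  have hn' := descend n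
  rw [div_lt_iff₀ (by positivity)] at hn
  rwa [max_eq_right (by linarith), zero_smul, add_zero] at hn'

/-! ### Generalized inverses of adjointable operators with closed range. -/

namespace HilbertModule

variable {A M : Type*} [CStarAlgebra A] [PartialOrder A]
  [NormedAddCommGroup M] [NormedSpace ℂ M] [Module A M] [CStarModule A M]

-- Allows `A`-linear maps to be viewed as real-linear ones, for the open mapping theorem and the
-- invertibility criterion.
variable (A M) in
theorem isScalarTower_real : IsScalarTower ℝ A M where
  smul_assoc r a x := by
    have key (y : M) : inner A y ((r • a) • x - r • a • x) = 0 := by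
      rw [CStarModule.inner_sub_right, CStarModule.inner_op_smul_right,
        CStarModule.inner_smul_right_real, CStarModule.inner_op_smul_right, smul_mul_assoc,
        sub_self]
    exact sub_eq_zero.1 (CStarModule.inner_self.1 (key _))

theorem mem_orthogonal_range_iff {F G : M →L[A] M} (hG : ∀ x y, inner A (F x) y = inner A x (G y))
    {y : M} : y ∈ orthogonal (LinearMap.range (F : M →ₗ[A] M)) ↔ G y = 0 := by
  constructor
  · intro h
    refine CStarModule.inner_self (A := A).1 ?_
    rw [← hG]
    exact h _ ⟨_, rfl⟩
  · rintro h _ ⟨x, rfl⟩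
    rw [ContinuousLinearMap.coe_coe, hG, h, CStarModule.inner_zero_right]

theorem apply_eq_zero_of_adjoint_apply_eq_zero {F G : M →L[A] M}
    (hG : ∀ x y, inner A (F x) y = inner A x (G y)) {x : M} (h : G (F x) = 0) : F x = 0 := by
  refine CStarModule.inner_self (A := A).1 ?_
  rw [hG, h, CStarModule.inner_zero_right]

theorem inner_adjoint_left {F G : M →L[A] M}
    (hG : ∀ x y, inner A (F x) y = inner A x (G y)) (x y : M) :
    inner A (G x) y = inner A x (F y) := by
  rw [← CStarModule.star_inner, ← hG, CStarModule.star_inner]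

variable [StarOrderedRing A] [CompleteSpace M]

/-- `F F^*` restricts to a topological automorphism of the closed range of `F`. -/
theorem exists_equiv_range {F G : M →L[A] M} (hG : ∀ x y, inner A (F x) y = inner A x (G y))
    (hcl : IsClosed (Set.range F)) :
    ∃ e : LinearMap.range (F : M →ₗ[A] M) ≃L[A] LinearMap.range (F : M →ₗ[A] M),
      ∀ y, (e y : M) = F (G y) := by
  have := isScalarTower_real A M
  set R := LinearMap.range (F : M →ₗ[A] M) with hR
  have hRc : IsClosed (R : Set M) := by
    rw [hR, LinearMap.coe_range]
    exact hcl
  have : CompleteSpace R := hRc.completeSpace_coe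
  let F₀ : M →L[A] R := F.codRestrict R fun x => ⟨x, rfl⟩
  let P : R →L[A] R := F₀.comp (G.comp R.subtypeL)
  have hP (y : R) : (P y : M) = F (G y) := rfl
  -- Open mapping theorem onto the closed range; pairing `y` with a controlled preimage then bounds
  -- `G` below on the range.
  obtain ⟨C, hC, hpre⟩ := (F₀.restrictScalars ℝ).exists_preimage_norm_le (by
    rintro ⟨_, x, rfl⟩
    exact ⟨x, rfl⟩)
  have hGbelow (y : R) : ‖y‖ ≤ C * ‖G y‖ := by
    obtain ⟨x, hx, hxn⟩ := hpre y
    have hFx : F x = y := congrArg Subtype.val hx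
    rcases (norm_nonneg y).eq_or_lt with h0 | h0
    · rw [← h0]; positivity
    have h1 : ‖y‖ * ‖y‖ ≤ ‖x‖ * ‖G y‖ := by
      calc ‖y‖ * ‖y‖ = ‖(y : M)‖ ^ 2 := by rw [sq]; rfl
        _ = ‖inner A (y : M) (y : M)‖ := CStarModule.norm_sq_eq A
        _ = ‖inner A x (G y)‖ := by rw [← hG, hFx]
        _ ≤ ‖x‖ * ‖G y‖ := CStarModule.norm_inner_le M
    have h2 : ‖x‖ * ‖G y‖ ≤ C * ‖y‖ * ‖G y‖ := by gcongr
    nlinarith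
  -- ⟨y, Py + sy⟩ = ⟨Gy, Gy⟩ + s⟨y, y⟩ ≥ ⟨Gy, Gy⟩, whose norm is at least `‖y‖² / C²`.
  have hunit : IsUnit (P.restrictScalars ℝ) := by
    refine ContinuousLinearMap.isUnit_of_forall_le_norm_add_smul _ (c := (C ^ 2)⁻¹)
      (by positivity) fun s hs y => ?_
    rcases (norm_nonneg y).eq_or_lt with h0 | h0
    · rw [← h0]; simp
    have h1 : ‖G y‖ ^ 2 ≤ ‖P y + s • y‖ * ‖y‖ := by
      calc ‖G y‖ ^ 2 = ‖inner A (G y) (G y)‖ := CStarModule.norm_sq_eq A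
        _ ≤ ‖inner A (y : M) (F (G y) + s • (y : M))‖ := by
          refine CStarAlgebra.norm_le_norm_of_nonneg_of_le CStarModule.inner_self_nonneg ?_
          rw [CStarModule.inner_add_right, ← inner_adjoint_left hG,
            CStarModule.inner_smul_right_real]
          exact le_add_of_nonneg_right (smul_nonneg hs CStarModule.inner_self_nonneg)
        _ ≤ ‖(y : M)‖ * ‖F (G y) + s • (y : M)‖ := CStarModule.norm_inner_le M
        _ = ‖P y + s • y‖ * ‖y‖ := by rw [mul_comm]; rfl
    have h2 : ‖y‖ ^ 2 ≤ C ^ 2 * ‖G y‖ ^ 2 := by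
      rw [← mul_pow]
      exact pow_le_pow_left₀ (norm_nonneg _) (hGbelow y) 2
    have h3 : ‖y‖ ≤ ‖P y + s • y‖ * C ^ 2 := by
      have : C ^ 2 * ‖G y‖ ^ 2 ≤ C ^ 2 * (‖P y + s • y‖ * ‖y‖) := by gcongr
      nlinarith
    rw [inv_mul_le_iff₀ (by positivity), mul_comm]
    exact h3
  obtain ⟨u, hu⟩ := hunit
  have hPu (y : R) : P y = (u : R →L[ℝ] R) y := by rw [hu]; rfl
  have hl (y : R) : (↑u⁻¹ : R →L[ℝ] R) (P y) = y := by
    rw [hPu, ← mul_apply_eq_comp, Units.inv_mul, one_apply_eq_self]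
  have hr (y : R) : P ((↑u⁻¹ : R →L[ℝ] R) y) = y := by
    rw [hPu, ← mul_apply_eq_comp, Units.mul_inv, one_apply_eq_self]
  exact ⟨{ (P : R →ₗ[A] R) with
    invFun := (↑u⁻¹ : R →L[ℝ] R)
    left_inv := hl
    right_inv := hr
    continuous_toFun := P.continuous
    continuous_invFun := (↑u⁻¹ : R →L[ℝ] R).continuous }, hP⟩

/-- An adjointable operator `F` with closed range has a generalized inverse `T`, and `F T` can be
taken to be the projection onto the range of `F` along its orthogonal complement. -/
theorem exists_generalized_inverse {F : M →L[A] M} (hF : IsAdjointable F)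
    (hcl : IsClosed (Set.range F)) :
    ∃ T : M →L[A] M, (∀ x, F (T (F x)) = F x) ∧
      (∀ y, y - F (T y) ∈ orthogonal (LinearMap.range (F : M →ₗ[A] M))) ∧
      ∀ y ∈ orthogonal (LinearMap.range (F : M →ₗ[A] M)), F (T y) = 0 := by
  obtain ⟨G, hG⟩ := hF
  obtain ⟨e, he⟩ := exists_equiv_range hG hcl
  let R := LinearMap.range (F : M →ₗ[A] M)
  let F₀ : M →L[A] R := F.codRestrict R fun x => ⟨x, rfl⟩
  -- T = F*(FF*)⁻²FF*: the factor (FF*)⁻¹FF* projects onto Im F, and F*(FF*)⁻¹ lifts back through F.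
  let T : M →L[A] M := G.comp (R.subtypeL.comp
    ((e.symm : R →L[A] R).comp ((e.symm : R →L[A] R).comp (F₀.comp G))))
  have hFT (y : M) : F (T y) = (e.symm (F₀ (G y)) : M) := by
    change F (G (e.symm (e.symm (F₀ (G y))))) = _
    rw [← he, e.apply_symm_apply]
  refine ⟨T, fun x => ?_, fun y => ?_, fun y hy => ?_⟩
  · rw [hFT]
    have : F₀ (G (F x)) = e (F₀ x) := Subtype.ext (he (F₀ x)).symm
    rw [this, e.symm_apply_apply]
    rfl
  · rw [mem_orthogonal_range_iff hG]
    refine apply_eq_zero_of_adjoint_apply_eq_zero (F := G) (G := F) (inner_adjoint_left hG) ?_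
    rw [map_sub, map_sub, hFT, ← he, e.apply_symm_apply]
    exact sub_self _
  · rw [hFT, (mem_orthogonal_range_iff hG).1 hy, map_zero, map_zero]
    rfl

end HilbertModule

namespace FGHilbertModule

universe u

variable {A : Type u} [CStarAlgebra A] [PartialOrder A] [StarOrderedRing A]

/-- The direct sum of two finitely generated Hilbert modules. -/
noncomputable def prod (N N' : FGHilbertModule A) : FGHilbertModule A where
  -- The bare product has the sup norm; this synonym has the norm of the `A`-valued inner product.
  carrier := WithCStarModule A (N.carrier × N'.carrier)

/-- The direct sum of finitely generated Hilbert modules is topologically the product. -/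
noncomputable def prodEquiv (N N' : FGHilbertModule A) :
    (N.prod N').carrier ≃L[A] N.carrier × N'.carrier :=
  WithCStarModule.equivL (A := A) (E := N.carrier × N'.carrier) A

end FGHilbertModule

/-! ### Splittings of kernels and complements, from generalized inverses alone. -/

namespace HilbertModule

section Decomposition

variable {A M : Type*} [Ring A] [AddCommGroup M] [TopologicalSpace M] [IsTopologicalAddGroup M]
  [Module A M] {F D R Q U : M →L[A] M}

/-- `ker (D F) ≅ ker F ⊕ (Im F ∩ ker D)` if `F` has a generalized inverse. -/
theorem nonempty_ker_comp_equiv (hR : ∀ x, F (R (F x)) = F x) :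
    Nonempty (LinearMap.ker (D.comp F : M →ₗ[A] M) ≃L[A]
      LinearMap.ker (F : M →ₗ[A] M) ×
        ↥(LinearMap.range (F : M →ₗ[A] M) ⊓ LinearMap.ker (D : M →ₗ[A] M))) := by
  have hRI (i : ↥(LinearMap.range (F : M →ₗ[A] M) ⊓ LinearMap.ker (D : M →ₗ[A] M))) :
      F (R i) = i := by
    obtain ⟨x, hx⟩ := i.2.1
    rw [← hx]
    exact hR x
  let f := (((ContinuousLinearMap.id A M - R.comp F).codRestrict (LinearMap.ker (F : M →ₗ[A] M))
    fun x => by simp [hR]).comp (LinearMap.ker (D.comp F : M →ₗ[A] M)).subtypeL).prod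
    ((F.comp (LinearMap.ker (D.comp F : M →ₗ[A] M)).subtypeL).codRestrict
      (LinearMap.range (F : M →ₗ[A] M) ⊓ LinearMap.ker (D : M →ₗ[A] M))
      fun x => ⟨⟨x, rfl⟩, x.2⟩)
  let g := ((LinearMap.ker (F : M →ₗ[A] M)).subtypeL.coprod (R.comp
    (LinearMap.range (F : M →ₗ[A] M) ⊓ LinearMap.ker (D : M →ₗ[A] M)).subtypeL)).codRestrict
      (LinearMap.ker (D.comp F : M →ₗ[A] M)) fun x => by
        have h1 : F x.1 = 0 := x.1.2
        have h2 : D x.2 = 0 := x.2.2.2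
        simp [h1, h2, hRI]
  refine ⟨ContinuousLinearEquiv.equivOfInverse f g (fun x => ?_) (fun x => ?_)⟩
  · refine Subtype.ext ?_
    change ((x : M) - R (F x)) + R (F x) = x
    abel
  · have h1 : F x.1 = 0 := x.1.2
    refine Prod.ext (Subtype.ext ?_) (Subtype.ext ?_)
    · change ((x.1 : M) + R x.2) - R (F (x.1 + R x.2)) = x.1
      rw [map_add, h1, hRI, zero_add, add_sub_cancel_right]
    · change F (x.1 + R x.2) = x.2
      rw [map_add, h1, hRI, zero_add]

/-- A submodule `K` containing the range `I` of a projection `q` is the sum of `I` and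
`K ∩ ker q`. -/
theorem nonempty_equiv_prod_inf_ker {K I : Submodule A M} (hIK : I ≤ K) {q : M →L[A] M}
    (hq : ∀ x, q x ∈ I) (hqI : ∀ x ∈ I, q x = x) :
    Nonempty (K ≃L[A] I × ↥(K ⊓ LinearMap.ker (q : M →ₗ[A] M))) := by
  let f := ((q.codRestrict I hq).comp K.subtypeL).prod
    (((ContinuousLinearMap.id A M - q).comp K.subtypeL).codRestrict
      (K ⊓ LinearMap.ker (q : M →ₗ[A] M)) fun x =>
        ⟨K.sub_mem x.2 (hIK (hq _)), by simp [hqI _ (hq _)]⟩)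
  let g := (I.subtypeL.coprod (K ⊓ LinearMap.ker (q : M →ₗ[A] M)).subtypeL).codRestrict K
    fun x => K.add_mem (hIK x.1.2) x.2.2.1
  refine ⟨ContinuousLinearEquiv.equivOfInverse f g (fun x => ?_) (fun x => ?_)⟩
  · refine Subtype.ext ?_
    change q x + ((x : M) - q x) = x
    abel
  · have h1 := hqI _ x.1.2
    have h2 : q x.2 = 0 := x.2.2.2
    refine Prod.ext (Subtype.ext ?_) (Subtype.ext ?_)
    · change q (x.1 + x.2) = x.1
      rw [map_add, h1, h2, add_zero]
    · change ((x.1 : M) + x.2) - q (x.1 + x.2) = x.2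
      rw [map_add, h1, h2, add_zero, add_sub_cancel_left]

/-- If `W` complements `Im F`, then `W ≅ (ker D ∩ ker q) ⊕ Im τ`, where `q` projects onto
`Im F ∩ ker D` and `τ` is a projection with kernel `Im F + ker D`. -/
theorem nonempty_complement_equiv {W : Submodule A M} {q τ : M →L[A] M}
    (hR : ∀ x, F (R (F x)) = F x) (hRW : ∀ y, y - F (R y) ∈ W) (hW : ∀ y ∈ W, F (R y) = 0)
    (hU : ∀ x, D (F (U (D (F x)))) = D (F x))
    (hq : ∀ x, q x ∈ LinearMap.range (F : M →ₗ[A] M) ⊓ LinearMap.ker (D : M →ₗ[A] M))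
    (hqI : ∀ x ∈ LinearMap.range (F : M →ₗ[A] M) ⊓ LinearMap.ker (D : M →ₗ[A] M), q x = x)
    (hτ : ∀ x, τ (τ x) = τ x) (hDτ : ∀ x, D (τ x) = D x - D (F (U (D x))))
    (hτD : ∀ x, D x = 0 → τ x = 0) (hτF : ∀ x, τ (F x) = 0) :
    Nonempty (W ≃L[A] ↥(LinearMap.ker (D : M →ₗ[A] M) ⊓ LinearMap.ker (q : M →ₗ[A] M)) ×
      LinearMap.range (τ : M →ₗ[A] M)) := by
  have hqD (x : M) : D (q x) = 0 := (hq x).2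
  have hqq (x : M) : q (q x) = q x := hqI _ (hq x)
  -- D(x - τx) lies in Im DF, so subtracting its lift FUD(x - τx) ∈ Im F moves x - τx into ker D.
  let k₀ : M →L[A] M := (ContinuousLinearMap.id A M - F.comp (U.comp D)).comp
    (ContinuousLinearMap.id A M - τ)
  have hk₀ (x : M) : k₀ x = x - τ x - F (U (D (x - τ x))) := rfl
  have hDk₀ (x : M) : D (k₀ x) = 0 := by
    rw [hk₀, map_sub, map_sub, hDτ, sub_sub_cancel, hU, sub_self]
  let f := (((k₀ - q.comp k₀).codRestrict
    (LinearMap.ker (D : M →ₗ[A] M) ⊓ LinearMap.ker (q : M →ₗ[A] M)) fun x =>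
      ⟨by simp [hDk₀, hqD], by simp [hqq]⟩).comp W.subtypeL).prod
    ((τ.codRestrict (LinearMap.range (τ : M →ₗ[A] M)) fun x => ⟨x, rfl⟩).comp W.subtypeL)
  let g := (((ContinuousLinearMap.id A M - F.comp R).comp
    ((LinearMap.ker (D : M →ₗ[A] M) ⊓ LinearMap.ker (q : M →ₗ[A] M)).subtypeL.coprod
      (LinearMap.range (τ : M →ₗ[A] M)).subtypeL)).codRestrict W fun x => hRW _)
  refine ⟨ContinuousLinearEquiv.equivOfInverse f g (fun x => ?_) (fun x => ?_)⟩
  · refine Subtype.ext ?_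
    change (k₀ x - q (k₀ x) + τ x) - F (R (k₀ x - q (k₀ x) + τ x)) = x
    obtain ⟨v, hv : F v = q (k₀ x)⟩ := (hq (k₀ x)).1
    have hx : k₀ x - q (k₀ x) + τ x = x - F (U (D (x - τ x)) + v) := by
      rw [map_add, hv, hk₀]
      abel
    rw [hx, map_sub R, map_sub F (R x), hR, hW _ x.2]
    abel
  · obtain ⟨⟨k, hkD : D k = 0, hkq : q k = 0⟩, ⟨_, t, rfl⟩⟩ := x
    have hτx : τ (k + τ t - F (R (k + τ t))) = τ t := by
      rw [map_sub, map_add, hτD k hkD, hτF, hτ, zero_add, sub_zero]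
    have hkx : k₀ (k + τ t - F (R (k + τ t))) =
        k + (F (U (D (F (R (k + τ t))))) - F (R (k + τ t))) := by
      rw [hk₀, hτx, show k + τ t - F (R (k + τ t)) - τ t = k - F (R (k + τ t)) by abel,
        map_sub D, hkD, zero_sub, map_neg, map_neg]
      abel
    have hqx : q (F (U (D (F (R (k + τ t))))) - F (R (k + τ t))) =
        F (U (D (F (R (k + τ t))))) - F (R (k + τ t)) := by
      refine hqI _ ⟨⟨U (D (F (R (k + τ t)))) - R (k + τ t), map_sub F _ _⟩, ?_⟩
      change D _ = 0
      rw [map_sub, hU, sub_self]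
    refine Prod.ext (Subtype.ext ?_) (Subtype.ext ?_)
    · change k₀ (k + τ t - F (R (k + τ t))) - q (k₀ (k + τ t - F (R (k + τ t)))) = k
      rw [hkx, map_add q, hkq, hqx, zero_add, add_sub_cancel_right]
    · exact hτx

/-- If `W` complements `Im (D F)` and `V` complements `Im D`, then `W ≅ V ⊕ Im τ`, where `τ` is a
projection with kernel `Im F + ker D`. -/
theorem nonempty_complement_comp_equiv {V W : Submodule A M} {τ : M →L[A] M}
    (hQ : ∀ x, D (Q (D x)) = D x) (hQV : ∀ y, y - D (Q y) ∈ V) (hV : ∀ y ∈ V, D (Q y) = 0)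
    (hU : ∀ x, D (F (U (D (F x)))) = D (F x))
    (hUW : ∀ y, y - D (F (U y)) ∈ W) (hW : ∀ y ∈ W, D (F (U y)) = 0)
    (hτ : ∀ x, τ x = Q (D x - D (F (U (D x))))) :
    Nonempty (W ≃L[A] V × LinearMap.range (τ : M →ₗ[A] M)) := by
  have hDτ (x : M) : D (τ x) = D x - D (F (U (D x))) := by
    rw [hτ, ← map_sub D, hQ]
  have hττ (x : M) : τ (τ x) = τ x := by
    rw [hτ (τ x), hDτ, map_sub U, map_sub F, map_sub D, hU, sub_self, sub_zero, ← hτ]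
  let f := ((ContinuousLinearMap.id A M - D.comp Q).codRestrict V hQV).comp W.subtypeL |>.prod
    ((τ.codRestrict (LinearMap.range (τ : M →ₗ[A] M)) fun x => ⟨x, rfl⟩).comp
      (Q.comp W.subtypeL))
  -- D is injective on Im τ, with image a complement of Im DF in Im D; projecting along Im DF lands
  -- in `W`.
  let g := ((ContinuousLinearMap.id A M - D.comp (F.comp U)).codRestrict W hUW).comp
    (V.subtypeL.coprod (D.comp (LinearMap.range (τ : M →ₗ[A] M)).subtypeL))
  refine ⟨ContinuousLinearEquiv.equivOfInverse f g (fun x => ?_) (fun x => ?_)⟩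
  · refine Subtype.ext ?_
    change ((x : M) - D (Q x) + D (τ (Q x))) - D (F (U (x - D (Q x) + D (τ (Q x))))) = x
    have hx : (x : M) - D (Q x) + D (τ (Q x)) = x - D (F (U (D (Q x)))) := by
      rw [hDτ]
      abel
    rw [hx, map_sub U, map_sub F, map_sub D, hU, hW _ x.2]
    abel
  · obtain ⟨⟨a, ha⟩, ⟨_, t, rfl⟩⟩ := x
    refine Prod.ext (Subtype.ext ?_) (Subtype.ext ?_)
    · change (a + D (τ t) - D (F (U (a + D (τ t))))) -
        D (Q (a + D (τ t) - D (F (U (a + D (τ t)))))) = a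
      rw [map_sub Q, map_sub D, map_add Q, map_add D (Q a), hQ, hQ, hV a ha]
      abel
    · change τ (Q (a + D (τ t) - D (F (U (a + D (τ t)))))) = τ t
      have hD : D (Q (a + D (τ t) - D (F (U (a + D (τ t)))))) =
          D (τ t) - D (F (U (a + D (τ t)))) := by
        rw [map_sub Q, map_sub D, map_add Q, map_add D (Q a), hQ, hQ, hV a ha, zero_add]
      rw [hτ, hD, map_sub U, map_sub F, map_sub D, hU, sub_sub_sub_cancel_right, ← hτ, hττ]

end Decomposition

end HilbertModule

/-! ### Assembly of the four splittings. -/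

theorem mainTheorem9 {A M : Type*}
    [CStarAlgebra A] [PartialOrder A] [StarOrderedRing A]
    [NormedAddCommGroup M] [NormedSpace ℂ M] [Module A M] [CStarModule A M] [CompleteSpace M]
    (F D : M →L[A] M)
    (hF : IsStablyGeneralizedWeyl F) (hD : IsStablyGeneralizedWeyl D)
    (hDF : IsClosed (Set.range (D.comp F))) :
    IsStablyGeneralizedWeyl (D.comp F) := by
  obtain ⟨hFadj, hFcl, N₁, N₁', ⟨e₁⟩⟩ := hF
  obtain ⟨hDadj, hDcl, N₂, N₂', ⟨e₂⟩⟩ := hD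
  have hadj : HilbertModule.IsAdjointable (D.comp F) := by
    obtain ⟨G, hG⟩ := hFadj
    obtain ⟨H, hH⟩ := hDadj
    exact ⟨G.comp H, fun x y => (hH _ _).trans (hG _ _)⟩
  obtain ⟨R, hR, hRW, hRW'⟩ := HilbertModule.exists_generalized_inverse hFadj hFcl
  obtain ⟨Q, hQ, hQW, hQW'⟩ := HilbertModule.exists_generalized_inverse hDadj hDcl
  obtain ⟨U, hU, hUW, hUW'⟩ := HilbertModule.exists_generalized_inverse hadj hDF
  simp only [ContinuousLinearMap.comp_apply] at hU hUW hUW'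
  -- Lift by `R`, project onto ker DF by 1 - UDF, and push forward by `F`.
  let q : M →L[A] M := (F.comp (ContinuousLinearMap.id A M - U.comp (D.comp F))).comp R
  have hq (x : M) : q x = F (R x - U (D (F (R x)))) := rfl
  let τ : M →L[A] M := Q.comp ((ContinuousLinearMap.id A M - (D.comp F).comp U).comp D)
  have hτ (x : M) : τ x = Q (D x - D (F (U (D x)))) := rfl
  have hDτ (x : M) : D (τ x) = D x - D (F (U (D x))) := by
    rw [hτ, ← map_sub D, hQ]
  have hqmem (x : M) : q x ∈
      LinearMap.range (F : M →ₗ[A] M) ⊓ LinearMap.ker (D : M →ₗ[A] M) := by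
    refine ⟨⟨_, (hq x).symm⟩, ?_⟩
    change D (q x) = 0
    rw [hq, map_sub, map_sub, hU, sub_self]
  have hqid : ∀ x ∈ LinearMap.range (F : M →ₗ[A] M) ⊓ LinearMap.ker (D : M →ₗ[A] M),
      q x = x := by
    rintro _ ⟨⟨x, rfl⟩, hx : D (F x) = 0⟩
    change q (F x) = F x
    rw [hq, map_sub, hR, hx, map_zero, map_zero, sub_zero]
  obtain ⟨a⟩ := HilbertModule.nonempty_ker_comp_equiv (D := D) hR
  obtain ⟨b⟩ := HilbertModule.nonempty_equiv_prod_inf_ker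
    (K := LinearMap.ker (D : M →ₗ[A] M)) inf_le_right hqmem hqid
  obtain ⟨c⟩ := HilbertModule.nonempty_complement_equiv (τ := τ) hR hRW hRW' hU hqmem hqid
    (fun x => by rw [hτ (τ x), hDτ, map_sub U, map_sub F, map_sub D, hU, sub_self, sub_zero, ← hτ])
    hDτ (fun x hx => by simp [hτ, hx]) (fun x => by rw [hτ, hU, sub_self, map_zero])
  obtain ⟨d⟩ := HilbertModule.nonempty_complement_comp_equiv hQ hQW hQW' hU hUW hUW' hτ
  refine ⟨hadj, hDF, N₁.prod N₂, N₁'.prod N₂', ⟨?_⟩⟩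
  refine ((N₁.prodEquiv N₂).prodCongr a).trans ?_
  refine (ContinuousLinearEquiv.prodProdProdComm A _ _ _ _).trans ?_
  -- Replace N₁ ⊕ ker F by N₁' ⊕ T ⊕ K; the freed K then joins I to form ker D, and `e₂` applies.
  refine (((e₁.trans ((ContinuousLinearEquiv.refl A _).prodCongr
    (c.trans (ContinuousLinearEquiv.prodComm A _ _)))).trans
      (ContinuousLinearEquiv.prodAssoc A _ _ _).symm).prodCongr
        (ContinuousLinearEquiv.refl A _)).trans ?_
  refine (ContinuousLinearEquiv.prodAssoc A _ _ _).trans ?_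
  refine ((ContinuousLinearEquiv.refl A _).prodCongr
    ((ContinuousLinearEquiv.prodComm A _ _).trans
      ((ContinuousLinearEquiv.prodAssoc A _ _ _).trans
        (((ContinuousLinearEquiv.refl A _).prodCongr b.symm).trans e₂)))).trans ?_
  refine (ContinuousLinearEquiv.prodProdProdComm A _ _ _ _).trans ?_
  exact (N₁'.prodEquiv N₂').symm.prodCongr
    ((ContinuousLinearEquiv.prodComm A _ _).trans d.symm)
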